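/- Graphs are finite and undirected and may have loops (i.e. a graph is a symmetric binary relation on a finite set $V(H)$). For a graph $H$, let $\mathrm{Hom}(K_2,H)$ be the simplicial complex whose vertices are the oriented edges $(u,v)$ of $H$ and whose faces are the non-empty sets $\sigma$ of oriented edges such that $(u,v')$ is an oriented edge for all $(u,v),(u',v')\in\sigma$; its geometric realisation $|\mathrm{Hom}(K_2,H)|$ carries the $\mathbb{Z}_2$-action induced by $(u,v)\mapsto(v,u)$, and the circle $\mathcal{S}^1\subseteq\mathbb{R}^2$ carries the action $x\mapsto -x$. A $\mathbb{Z}_2$-map is a continuous map commuting with the $\mathbb{Z}_2$-actions. Let $C_n$ be the cycle with vertex set $\mathbb{Z}/n$ and edges $\{i,i+1\}$ (so $C_1$ is a vertex with a loop), and let $\mathrm{Pol}(G,H)$ be the set of all polymorphisms, i.e. functions $f\colon V(G)^L\to V(H)$, $L\in\mathbb{N}$, such that $(f(u_1,\dots,u_L),f(v_1,\dots,v_L))$ is an edge of $H$ whenever $(u_1,v_1),\dots,(u_L,v_L)$ are edges of $G$. For $\pi\colon\{1,\dots,m\}\to\{1,\dots,n\}$, the minor of $g\colon A^m\to B$ given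 by $\pi$ is $(x_1,\dots,x_n)\mapsto g(x_{\pi(1)},\dots,x_{\pi(m)})$. A minion on a pair of sets $(A,B)$ is a non-empty set of functions $A^n\to B$, of possibly different arities $n\in\mathbb{N}$, closed under taking minors. A minion homomorphism is a map that preserves arities and taking minors. The essential arity of a function is the number of coordinates $i$ such that changing the $i$-th argument alone can change the value; a minion has bounded essential arity if some $k$ bounds the essential arity of all its members; a constant function is one without essential coordinates. **Theorem.** Let $H$ be a graph such that there is a $\mathbb{Z}_2$-map $|\mathrm{Hom}(K_2,H)|\to\mathcal{S}^1$. Then for every odd $n\ge 1$ there are sets $A,B$ and a minion $\mathscr{M}$ on $(A,B)$ of bounded essential arity and containing no constant functions such that there is a minion homomorphism $\mathrm{Pol}(C_n,H)\to\mathscr{M}$. (If $C_n$ has no homomorphism to $H$, then $\mathrm{Pol}(C_n,H)$ is empty and the empty map counts as such a homomorphism.) -/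

import Mathlib

universe u v w

/-! ### Graphs with loops allowed -/

/-- An undirected graph, possibly with loops: a symmetric binary relation. -/
structure LoopGraph (V : Type u) extends Digraph V where
  symm : ∀ a b : V, Adj a b → Adj b a

namespace LoopGraph

/-- The cycle on the vertex set `ℤ/n`, with edges between `i` and `i + 1`
(for `n = 1` this is a single vertex with a loop). -/
def cycle (n : ℕ) : LoopGraph (ZMod n) where
  Adj i j := j = i + 1 ∨ i = j + 1
  symm _ _ h := h.symm

/-- The oriented edges of `G`, that is, the homomorphisms from `K₂` to `G`. -/
def Dart {V : Type u} (G : LoopGraph V) : Type u :=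
  {e : V × V // G.Adj e.1 e.2}

/-- The oriented edge with the opposite orientation, as a permutation of the oriented edges. -/
def dartSwap {V : Type u} (G : LoopGraph V) : Equiv.Perm G.Dart where
  toFun e := ⟨(e.1.2, e.1.1), G.symm _ _ e.2⟩
  invFun e := ⟨(e.1.2, e.1.1), G.symm _ _ e.2⟩
  left_inv _ := rfl
  right_inv _ := rfl

end LoopGraph

/-! ### `ℤ₂`-complexes, `ℤ₂`-spaces and `ℤ₂`-maps -/

/-- A `ℤ₂`-complex with vertex set `ι`: a simplicial complex together with an involution
of its vertices that maps faces to faces. -/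
structure Z2Complex (ι : Type u) extends AbstractSimplicialComplex ι where
  antipode : Equiv.Perm ι
  antipode_antipode : ∀ a : ι, antipode (antipode a) = a
  antipode_mem : ∀ s ∈ faces, s.map antipode.toEmbedding ∈ faces

namespace Z2Complex

variable {ι : Type u}

open Classical in
/-- The geometric realisation `|K| ⊆ ℝ^ι`: the union, over all faces `s` of `K`, of the convex
hulls of the standard basis vectors `e_a` with `a ∈ s`. -/
def realizationSet (K : Z2Complex ι) : Set (ι → ℝ) :=
  ⋃ s ∈ K.faces, convexHull ℝ ((fun a : ι => (Pi.single a 1 : ι → ℝ)) '' (s : Set ι))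

/-- The geometric realisation as a topological space, a subspace of `ℝ^ι`. -/
def Realization (K : Z2Complex ι) : Type u := K.realizationSet

instance (K : Z2Complex ι) : TopologicalSpace K.Realization :=
  inferInstanceAs (TopologicalSpace K.realizationSet)

theorem comp_antipode_mem (K : Z2Complex ι) {x : ι → ℝ} (hx : x ∈ K.realizationSet) :
    x ∘ K.antipode ∈ K.realizationSet := by
  classical
  simp only [realizationSet, Set.mem_iUnion, exists_prop] at hx ⊢
  obtain ⟨s, hs, hx⟩ := hx
  refine ⟨s.map K.antipode.toEmbedding, K.antipode_mem s hs, ?_⟩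
  have h1 : LinearMap.funLeft ℝ ℝ K.antipode x ∈
      LinearMap.funLeft ℝ ℝ K.antipode ''
        convexHull ℝ ((fun a : ι => (Pi.single a 1 : ι → ℝ)) '' (s : Set ι)) :=
    Set.mem_image_of_mem _ hx
  rw [LinearMap.image_convexHull] at h1
  refine convexHull_mono ?_ h1
  rintro _ ⟨_, ⟨a, ha, rfl⟩, rfl⟩
  refine ⟨K.antipode a, ?_, ?_⟩
  · simpa using ha
  · funext b
    simp only [LinearMap.funLeft_apply, Pi.single_apply]
    congr 1
    apply propext
    constructor
    · rintro rfl
      exact K.antipode_antipode a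
    · rintro rfl
      exact (K.antipode_antipode b).symm

/-- The induced `ℤ₂`-action on `|K|`, sending `∑ λ_a e_a` to `∑ λ_a e_{-a}`. -/
instance (K : Z2Complex ι) : InvolutiveNeg K.Realization where
  neg x := ⟨x.1 ∘ K.antipode, K.comp_antipode_mem x.2⟩
  neg_neg x := Subtype.ext (funext fun a => congrArg x.1 (K.antipode_antipode a))

end Z2Complex

/-- `X →_{ℤ₂} Y`: there is a continuous map from `X` to `Y` that commutes with the involutions
`x ↦ -x` of the two `ℤ₂`-spaces. -/
def Z2MapsTo (X : Type u) (Y : Type v) [TopologicalSpace X] [InvolutiveNeg X]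
    [TopologicalSpace Y] [InvolutiveNeg Y] : Prop :=
  ∃ g : C(X, Y), ∀ x : X, g (-x) = -g x

/-- The sphere `𝕊ᵈ`, the unit sphere in Euclidean `ℝ^(d+1)`; its `ℤ₂`-action is `x ↦ -x`. -/
abbrev Z2Sphere (d : ℕ) : Type :=
  Metric.sphere (0 : EuclideanSpace ℝ (Fin (d + 1))) 1

/-- The complex `Hom(K₂, G)`. Its vertices are the oriented edges of `G`; a non-empty finite set
`s` of oriented edges is a face if `(a, b')` is an oriented edge for all `(a, b), (a', b') ∈ s`.
The `ℤ₂`-action swaps `(a, b)` to `(b, a)`. -/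
def LoopGraph.homComplex {V : Type u} (G : LoopGraph V) : Z2Complex G.Dart where
  faces := {s | s.Nonempty ∧ ∀ e ∈ s, ∀ e' ∈ s, G.Adj e.1.1 e'.1.2}
  isRelLowerSet_faces := fun _ hs =>
    ⟨hs.1, fun _ hts ht => ⟨ht, fun e he e' he' => hs.2 e (hts he) e' (hts he')⟩⟩
  singleton_mem e := by
    refine ⟨Finset.singleton_nonempty e, fun a ha b hb => ?_⟩
    rw [Finset.mem_singleton.1 ha, Finset.mem_singleton.1 hb]
    exact e.2
  antipode := G.dartSwap
  antipode_antipode _ := rfl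
  antipode_mem := by
    rintro s ⟨hne, hs⟩
    refine ⟨hne.map, fun e he e' he' => ?_⟩
    obtain ⟨a, ha, rfl⟩ := Finset.mem_map.1 he
    obtain ⟨b, hb, rfl⟩ := Finset.mem_map.1 he'
    exact G.symm _ _ (hs b hb a ha)

/-! ### Minions -/

/-- A set of functions of several variables from `A` to `B`, sorted by arity. -/
abbrev FunctionFamily (A : Type u) (B : Type v) : Type (max u v) :=
  ∀ n : ℕ, Set ((Fin n → A) → B)

/-- The `n`-ary minor `f(x₁,…,xₙ) = g(x_{π(1)},…,x_{π(m)})` of an `m`-ary function `g`. -/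
def minorOf {A : Type u} {B : Type v} {m n : ℕ} (π : Fin m → Fin n) (g : (Fin m → A) → B) :
    (Fin n → A) → B :=
  fun x => g (x ∘ π)

/-- A minion on `(A, B)`: a non-empty set of functions that is closed under taking minors. -/
structure IsMinion {A : Type u} {B : Type v} (M : FunctionFamily A B) : Prop where
  nonempty : ∃ n, (M n).Nonempty
  minor_mem : ∀ {m n : ℕ} (π : Fin m → Fin n), ∀ g ∈ M m, minorOf π g ∈ M n

/-- The `i`-th coordinate of `f` is essential: changing it alone can change the value of `f`. -/
def IsEssentialCoord {A : Type u} {B : Type v} {n : ℕ} (f : (Fin n → A) → B) (i : Fin n) : Prop :=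
  ∃ (x : Fin n → A) (a a' : A), f (Function.update x i a) ≠ f (Function.update x i a')

/-- The number of essential coordinates. -/
noncomputable def essentialArity {A : Type u} {B : Type v} {n : ℕ} (f : (Fin n → A) → B) : ℕ :=
  {i : Fin n | IsEssentialCoord f i}.ncard

/-- Some `k` bounds the essential arity of all members. -/
def BoundedEssentialArity {A : Type u} {B : Type v} (M : FunctionFamily A B) : Prop :=
  ∃ k : ℕ, ∀ n, ∀ f ∈ M n, essentialArity f ≤ k

/-- No member is constant, that is, without essential coordinates. -/
def HasNoConstants {A : Type u} {B : Type v} (M : FunctionFamily A B) : Prop :=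
  ∀ n, ∀ f ∈ M n, ¬ ∀ i, ¬ IsEssentialCoord f i

/-- `ξ`, an arity-preserving map from `M` to `N`, preserves taking minors. -/
def IsMinionHom {A : Type u} {B : Type v} {A' : Type w} {B' : Type*}
    {M : FunctionFamily A B} {N : FunctionFamily A' B'} (ξ : ∀ n : ℕ, M n → N n) : Prop :=
  ∀ (m n : ℕ) (π : Fin m → Fin n) (g : M m) (h : minorOf π g.1 ∈ M n),
    (ξ n ⟨minorOf π g.1, h⟩).1 = minorOf π (ξ m g).1

/-- `Pol(G, H)`: the `n`-ary members are the homomorphisms from `Gⁿ` to `H`. -/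
def polymorphisms {V : Type u} {W : Type v} (G : LoopGraph V) (H : LoopGraph W) :
    FunctionFamily V W :=
  fun n => {f | ∀ x y : Fin n → V, (∀ i, G.Adj (x i) (y i)) → H.Adj (f x) (f y)}

/-- `Pol(G, H)` is a minion as soon as there is a homomorphism from `G` to `H`. -/
theorem polymorphisms_isMinion {V : Type u} {W : Type v} (G : LoopGraph V) (H : LoopGraph W)
    (φ : V → W) (hφ : ∀ a b, G.Adj a b → H.Adj (φ a) (φ b)) :
    IsMinion (polymorphisms G H) where
  nonempty := ⟨1, fun x => φ (x 0), fun _ _ h => hφ _ _ (h 0)⟩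
  minor_mem := fun π _ hg _ _ h => hg _ _ fun i => h (π i)

/-!
A `ℤ₂`-map from `|Hom(K₂, H)|` to the circle is turned into a discrete winding form `ω` on `H`.
The oriented edges `(y, x)` into a vertex `x` span a simplex, on which the map has an angle
function. An edge `x y` occurs in the simplices of both its ends, as the antipodal points `(y, x)`
and `(x, y)`, so the two angles differ by an odd number `ω x y` of half turns. All edges from
`{x, z}` to `{y, w}` span a simplex when `x, y, z, w` is a closed walk, and comparing angles there
shows that `ω` sums to zero around every closed walk of length four
(`LoopGraph.exists_isWindingForm`).

Given a polymorphism `f : C_nᴸ → H` and signs `ε ∈ {1, -1}ᴸ`, the walk `j ↦ j • ε` in `C_nᴸ` is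
closed after `n` steps; the sum of `ω` along its image under `f` is the winding `w_f(ε)`. The map
`f ↦ w_f` sends polymorphisms to functions `{1, -1}ᴸ → ℤ` and clearly preserves minors. The values
`w_f(ε)` are odd, as sums of `n` odd numbers, and bounded independently of `f` and `L`, since `H`
is finite.

It remains to see that `w_f(ε) = ∑ εᵢ αᵢ` for some integers `αᵢ`. As `ω` vanishes on squares, the
winding does not change when the walk is translated by a step, and hence, `n` being odd, not under
any translation (`IsWindingForm.windingFrom_eq`). It is therefore proportional to the sum `Ω(ε)`
of `ω` over all edges `f(v) f(v + ε)` (`IsWindingForm.totalForm_eq`). The square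
`v, v + ε, v + ε + ε', v + η`, where `ε + ε' = η + η'`, gives `Ω(ε) + Ω(ε') = Ω(η) + Ω(η')`
(`IsWindingForm.totalForm_add_totalForm`), so switching one sign has an effect independent of the
other signs. With `Ω(-ε) = -Ω(ε)` this gives linearity (`exists_isSignedLinear`).

The weights satisfy `∑ αᵢ = w_f(1, …, 1)`, which is odd, so some `αᵢ` is nonzero and `w_f` is not
constant; and `∑ |αᵢ|` is itself a value of `w_f`, so the number of essential coordinates is
bounded. The target minion consists of all such linear functions.
-/

/-! ### Angle functions on simplices -/

theorem Circle.exp_add_pi (t : ℝ) : Circle.exp (t + Real.pi) = -Circle.exp t := by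
  apply Circle.ext
  change ((Circle.exp (t + Real.pi) : Circle) : ℂ) = -((Circle.exp t : Circle) : ℂ)
  rw [Circle.coe_exp, Circle.coe_exp]
  push_cast
  rw [add_mul, Complex.exp_add, Complex.exp_pi_mul_I]
  ring

namespace Z2Complex

variable {ι : Type u} (K : Z2Complex ι)

open Classical in
/-- The vertex `e_a` of the realisation. -/
noncomputable def vertexPoint (a : ι) : ι → ℝ := Pi.single a 1

/-- The geometric simplex spanned by the vertices in `s`. -/
def simplexSet (s : Finset ι) : Set (ι → ℝ) := convexHull ℝ (vertexPoint '' (s : Set ι))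

theorem vertexPoint_mem_simplexSet {s : Finset ι} {a : ι} (ha : a ∈ s) :
    vertexPoint a ∈ simplexSet s :=
  subset_convexHull ℝ _ ⟨a, ha, rfl⟩

theorem simplexSet_mono {s t : Finset ι} (h : s ⊆ t) : simplexSet s ⊆ simplexSet t :=
  convexHull_mono (Set.image_mono (Finset.coe_subset.2 h))

theorem simplexSet_subset_realizationSet {s : Finset ι} (hs : s ∈ K.faces) :
    simplexSet s ⊆ K.realizationSet := fun x hx => by
  simp only [realizationSet, Set.mem_iUnion]
  exact ⟨s, hs, hx⟩

/-- A vector in the underlying set of the realisation, as a point of the realisation. -/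
def point {x : ι → ℝ} (hx : x ∈ K.realizationSet) : K.Realization := ⟨x, hx⟩

theorem point_congr {x y : ι → ℝ} (h : x = y) (hx : x ∈ K.realizationSet)
    (hy : y ∈ K.realizationSet) : K.point hx = K.point hy :=
  Subtype.ext h

theorem neg_point {x : ι → ℝ} (hx : x ∈ K.realizationSet) :
    -K.point hx = K.point (K.comp_antipode_mem hx) := rfl

theorem vertexPoint_comp_antipode (a : ι) :
    vertexPoint a ∘ K.antipode = vertexPoint (K.antipode a) := by
  classical
  funext b
  simp only [vertexPoint, Function.comp_apply, Pi.single_apply]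
  congr 1
  apply propext
  constructor
  · rintro rfl
    exact (K.antipode_antipode b).symm
  · rintro rfl
    exact K.antipode_antipode a

theorem comp_antipode_mem_simplexSet {s : Finset ι} {x : ι → ℝ}
    (hx : x ∈ simplexSet (s.map K.antipode.toEmbedding)) : x ∘ K.antipode ∈ simplexSet s := by
  have h1 := Set.mem_image_of_mem (LinearMap.funLeft ℝ ℝ K.antipode) hx
  rw [simplexSet, LinearMap.image_convexHull] at h1
  refine convexHull_mono ?_ h1
  rintro _ ⟨_, ⟨a, ha, rfl⟩, rfl⟩
  obtain ⟨b, hb, rfl⟩ := Finset.mem_map.1 (Finset.mem_coe.1 ha)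
  refine ⟨b, hb, ?_⟩
  change vertexPoint b = vertexPoint (K.antipode b) ∘ K.antipode
  rw [vertexPoint_comp_antipode, K.antipode_antipode]

variable {K}

/-- `Θ` is an angle function, that is, a continuous lift through `t ↦ exp (i t)`, of
`g : |K| → 𝕊¹` over the simplex spanned by `s`. The values of `Θ` elsewhere are irrelevant. -/
structure IsAngle (g : C(K.Realization, Circle)) (s : Finset ι) (Θ : (ι → ℝ) → ℝ) : Prop where
  continuousOn : ContinuousOn Θ (simplexSet s)
  exp_eq : ∀ x (hx : x ∈ K.realizationSet), x ∈ simplexSet s → Circle.exp (Θ x) = g (K.point hx)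

/-- A simplex is simply connected, so every circle-valued map has an angle function on it. -/
theorem exists_isAngle (g : C(K.Realization, Circle)) {s : Finset ι} (hs : s ∈ K.faces) :
    ∃ Θ, IsAngle g s Θ := by
  classical
  obtain ⟨a, ha⟩ : s.Nonempty := K.isRelLowerSet_faces hs |>.1
  have hconv : Convex ℝ (simplexSet s) := convex_convexHull ℝ _
  have hne : (simplexSet s).Nonempty := ⟨_, vertexPoint_mem_simplexSet ha⟩
  have : LocallyPathConnectedSpace (simplexSet s) := Convex.locallyPathConnectedSpace _ hconv
  have : ContractibleSpace (simplexSet s) := hconv.contractibleSpace hne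
  let f : C(simplexSet s, Circle) :=
    ⟨fun x => g (K.point (K.simplexSet_subset_realizationSet hs x.2)),
      g.continuous.comp (continuous_subtype_val.subtype_mk _)⟩
  let a₀ : simplexSet s := ⟨_, vertexPoint_mem_simplexSet ha⟩
  obtain ⟨t, ht⟩ := Circle.exp_surjective (f a₀)
  obtain ⟨F, ⟨-, hF⟩, -⟩ := Circle.isCoveringMap_exp.existsUnique_continuousMap_lifts f a₀ t ht
  refine ⟨fun x => if hx : x ∈ simplexSet s then F ⟨x, hx⟩ else 0, ?_, ?_⟩
  · rw [continuousOn_iff_continuous_domRestrict]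
    convert F.continuous using 1
    funext x
    simp
  · intro x hx hxs
    rw [dif_pos hxs]
    exact congrFun hF ⟨x, hxs⟩

namespace IsAngle

variable {g : C(K.Realization, Circle)} {s t : Finset ι} {Θ Θ' : (ι → ℝ) → ℝ}

theorem mono (h : IsAngle g t Θ) (hst : s ⊆ t) : IsAngle g s Θ :=
  ⟨h.continuousOn.mono (simplexSet_mono hst), fun x hx hxs => h.exp_eq x hx (simplexSet_mono hst hxs)⟩

/-- Two angle functions differ by a constant on each common face. -/
theorem sub_eq_sub (h : IsAngle g s Θ) (h' : IsAngle g t Θ') (hs : s ∈ K.faces) {a b : ι}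
    (has : a ∈ s) (hat : a ∈ t) (hbs : b ∈ s) (hbt : b ∈ t) :
    Θ (vertexPoint b) - Θ (vertexPoint a) = Θ' (vertexPoint b) - Θ' (vertexPoint a) := by
  classical
  have hus : s ∩ t ⊆ s := Finset.inter_subset_left
  have ha := Finset.mem_inter.2 ⟨has, hat⟩
  have hb := Finset.mem_inter.2 ⟨hbs, hbt⟩
  have hu : s ∩ t ∈ K.faces := (K.isRelLowerSet_faces hs).2 hus ⟨a, ha⟩
  replace h := h.mono hus
  replace h' := h'.mono (Finset.inter_subset_right : s ∩ t ⊆ t)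
  set c := Θ (vertexPoint a) - Θ' (vertexPoint a) with hc
  have hmem {x} (hx : x ∈ simplexSet (s ∩ t)) := K.simplexSet_subset_realizationSet hu hx
  have hc1 : Circle.exp c = 1 := by
    have hx := vertexPoint_mem_simplexSet ha
    rw [hc, Circle.exp_sub, h.exp_eq _ (hmem hx) hx, h'.exp_eq _ (hmem hx) hx, div_self']
  have key := Circle.isCoveringMap_exp.eqOn_of_comp_eqOn
    (s := simplexSet (s ∩ t)) (g₁ := Θ) (g₂ := fun x => Θ' x + c)
    (convex_convexHull ℝ _).isPreconnected h.continuousOn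
    (h'.continuousOn.add continuousOn_const)
    (fun x hx => by
      simp only [Function.comp_apply]
      rw [Circle.exp_add, hc1, mul_one, h.exp_eq _ (hmem hx) hx, h'.exp_eq _ (hmem hx) hx])
    (vertexPoint_mem_simplexSet ha) (by simp [hc])
  have := key (vertexPoint_mem_simplexSet hb)
  simp only at this
  linarith

/-- An equivariant map turns by half a turn between antipodal points. -/
theorem antipode (h : IsAngle g s Θ) (hg : ∀ x, g (-x) = -g x) :
    IsAngle g (s.map K.antipode.toEmbedding) fun x => Θ (x ∘ K.antipode) + Real.pi := by
  refine ⟨?_, fun x hx hxs => ?_⟩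
  · refine ContinuousOn.add (h.continuousOn.comp ?_ fun x hx => K.comp_antipode_mem_simplexSet hx)
      continuousOn_const
    exact (continuous_pi fun i => continuous_apply (K.antipode i)).continuousOn
  · rw [Circle.exp_add_pi, h.exp_eq _ (K.comp_antipode_mem hx) (K.comp_antipode_mem_simplexSet hxs),
      ← neg_point, hg, neg_neg]

end IsAngle

end Z2Complex

/-- The circle `𝕊¹ ⊆ ℝ²` as the unit circle of `ℂ`, so that the covering `t ↦ exp (i t)` applies. -/
theorem Z2MapsTo.exists_circle {X : Type u} [TopologicalSpace X] [InvolutiveNeg X]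
    (h : Z2MapsTo X (Z2Sphere 1)) : ∃ g : C(X, Circle), ∀ x, g (-x) = -g x := by
  obtain ⟨g, hg⟩ := h
  let e : EuclideanSpace ℝ (Fin 2) ≃ₗᵢ[ℝ] ℂ := Complex.orthonormalBasisOneI.repr.symm
  have hmem (x : X) : e (g x).1 ∈ Submonoid.unitSphere ℂ := by
    refine mem_sphere_zero_iff_norm.2 ?_
    rw [e.norm_map]
    exact mem_sphere_zero_iff_norm.1 (g x).2
  refine ⟨⟨fun x => ⟨e (g x).1, hmem x⟩, ?_⟩, fun x => ?_⟩
  · exact (e.continuous.comp (continuous_subtype_val.comp g.continuous)).subtype_mk _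
  · apply Circle.ext
    change e (g (-x)).1 = -e (g x).1
    rw [hg, ← map_neg]
    rfl

/-! ### The winding form of a graph -/

namespace LoopGraph

variable {V : Type u}

/-- A discrete winding form on `H`: an odd integer on each oriented edge, measuring the angle
along the edge in half turns, whose sum around each closed walk of length four vanishes. -/
structure IsWindingForm (H : LoopGraph V) (ω : V → V → ℤ) : Prop where
  odd : ∀ {x y}, H.Adj x y → Odd (ω x y)
  antisymm : ∀ {x y}, H.Adj x y → ω y x = -ω x y
  square : ∀ {x y z w}, H.Adj x y → H.Adj y z → H.Adj z w → H.Adj w x →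
    ω x y + ω y z + ω z w + ω w x = 0

/-- The oriented edge from `x` to `y`. -/
def dart (H : LoopGraph V) {x y : V} (h : H.Adj x y) : H.Dart := ⟨(x, y), h⟩

/-- The angles of a circle-valued `ℤ₂`-map along the star `{(y, x) | y}` of each vertex `x` compare
at the two ends of an edge `x y`, where they are angles at the antipodal points `(y, x)` and
`(x, y)`: they differ by an odd number of half turns. -/
theorem exists_isWindingForm [Finite V] (H : LoopGraph V)
    (hH : Z2MapsTo H.homComplex.Realization (Z2Sphere 1)) : ∃ ω, H.IsWindingForm ω := by
  classical
  obtain ⟨g, hg⟩ := hH.exists_circle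
  have : Finite H.Dart := inferInstanceAs (Finite {e : V × V // H.Adj e.1 e.2})
  have := Fintype.ofFinite H.Dart
  let star (x : V) : Finset H.Dart := Finset.univ.filter fun e => e.1.2 = x
  have mem_star {x y : V} (h : H.Adj y x) : H.dart h ∈ star x :=
    Finset.mem_filter.2 ⟨Finset.mem_univ _, rfl⟩
  have star_face {x y : V} (h : H.Adj y x) : star x ∈ H.homComplex.faces := by
    refine ⟨⟨_, mem_star h⟩, fun e he e' he' => ?_⟩
    simp only [star, Finset.mem_filter, Finset.mem_univ, true_and] at he he'
    rw [he', ← he]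
    exact e.2
  have hΘ (x : V) : ∃ Θ, ∀ y, H.Adj y x → Z2Complex.IsAngle g (star x) Θ := by
    by_cases hx : ∃ y, H.Adj y x
    · obtain ⟨y, hy⟩ := hx
      obtain ⟨Θ, h⟩ := Z2Complex.exists_isAngle g (star_face hy)
      exact ⟨Θ, fun _ _ => h⟩
    · exact ⟨0, fun y hy => (hx ⟨y, hy⟩).elim⟩
  choose Θ hΘ using hΘ
  -- `φ x y` is the angle at the oriented edge `(y, x)`, normalised over the star of `x`.
  let φ (x y : V) : ℝ := if h : H.Adj y x then Θ x (Z2Complex.vertexPoint (H.dart h)) else 0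
  have φ_eq {x y : V} (h : H.Adj y x) :
      φ x y = Θ x (Z2Complex.vertexPoint (H.dart h)) := dif_pos h
  have exp_φ {x y : V} (h : H.Adj x y) : Circle.exp (φ x y) = Circle.exp (φ y x + Real.pi) := by
    have h' := H.symm _ _ h
    have m := Z2Complex.vertexPoint_mem_simplexSet (mem_star h)
    have m' := Z2Complex.vertexPoint_mem_simplexSet (mem_star h')
    have r := H.homComplex.simplexSet_subset_realizationSet (star_face h) m
    have r' := H.homComplex.simplexSet_subset_realizationSet (star_face h') m'
    rw [Circle.exp_add_pi, φ_eq h, φ_eq h', (hΘ y x h).exp_eq _ r m, (hΘ x y h').exp_eq _ r' m',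
      ← hg, Z2Complex.neg_point]
    exact congrArg g (Z2Complex.point_congr _
      (H.homComplex.vertexPoint_comp_antipode (H.dart h)).symm _ _)
  have hω (x y : V) : ∃ k : ℤ, H.Adj x y → φ x y - φ y x = (2 * k + 1 : ℤ) * Real.pi := by
    by_cases h : H.Adj x y
    · obtain ⟨m, hm⟩ := Circle.exp_eq_exp.1 (exp_φ h)
      refine ⟨m, fun _ => ?_⟩
      push_cast
      linarith
    · exact ⟨0, fun h' => (h h').elim⟩
  choose k hk using hω
  refine ⟨fun x y => 2 * k x y + 1, fun _ => ⟨_, rfl⟩, fun {x y} h => ?_,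
    fun {x y z w} h1 h2 h3 h4 => ?_⟩
  · have e1 := hk x y h
    have e2 := hk y x (H.symm _ _ h)
    have e3 : ((2 * k y x + 1 : ℤ) : ℝ) = (-(2 * k x y + 1) : ℤ) :=
      mul_right_cancel₀ Real.pi_ne_zero (by push_cast at *; linarith)
    exact_mod_cast e3
  · have h1' := H.symm _ _ h1
    have h2' := H.symm _ _ h2
    have h3' := H.symm _ _ h3
    have h4' := H.symm _ _ h4
    -- Every edge from `{x, z}` to `{y, w}` belongs to the face `F`.
    let F : Finset H.Dart := {H.dart h1, H.dart h2', H.dart h3, H.dart h4'}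
    have hF : F ∈ H.homComplex.faces := by
      refine ⟨⟨H.dart h1, by simp [F]⟩, fun e he e' he' => ?_⟩
      simp only [F, Finset.mem_insert, Finset.mem_singleton] at he he'
      rcases he with rfl | rfl | rfl | rfl <;> rcases he' with rfl | rfl | rfl | rfl <;> assumption
    obtain ⟨Ψ, hΨ⟩ := Z2Complex.exists_isAngle g hF
    have mem_map {a b : V} (h : H.Adj a b) (ha : H.dart h ∈ F) :
        H.dart (H.symm _ _ h) ∈ F.map H.homComplex.antipode.toEmbedding :=
      Finset.mem_map.2 ⟨_, ha, rfl⟩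
    have value {a b : V} (h : H.Adj a b) :
        Ψ (Z2Complex.vertexPoint (H.dart (H.symm _ _ h)) ∘ H.homComplex.antipode) =
          Ψ (Z2Complex.vertexPoint (H.dart h)) := by
      rw [Z2Complex.vertexPoint_comp_antipode]
      rfl
    have m1 : H.dart h1 ∈ F := by simp [F]
    have m2 : H.dart h2' ∈ F := by simp [F]
    have m3 : H.dart h3 ∈ F := by simp [F]
    have m4 : H.dart h4' ∈ F := by simp [F]
    have hF' := H.homComplex.antipode_mem F hF
    have ey := hΨ.sub_eq_sub (hΘ y x h1) hF m1 (mem_star h1) m2 (mem_star h2')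
    have ew := hΨ.sub_eq_sub (hΘ w z h3) hF m3 (mem_star h3) m4 (mem_star h4')
    have ez := (hΨ.antipode hg).sub_eq_sub (hΘ z y h2) hF'
      (mem_map h2' m2) (mem_star h2) (mem_map h3 m3) (mem_star h3')
    have ex := (hΨ.antipode hg).sub_eq_sub (hΘ x w h4) hF'
      (mem_map h4' m4) (mem_star h4) (mem_map h1 m1) (mem_star h1')
    beta_reduce at ez ex
    rw [value h2', value h3] at ez
    rw [value h4', value h1] at ex
    rw [← φ_eq, ← φ_eq] at ex ey ez ew
    have e1 := hk x y h1
    have e2 := hk y z h2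
    have e3 := hk z w h3
    have e4 := hk w x h4
    have e5 : (((2 * k x y + 1) + (2 * k y z + 1) + (2 * k z w + 1) + (2 * k w x + 1) : ℤ) : ℝ) = 0 :=
      mul_right_cancel₀ Real.pi_ne_zero (by push_cast at *; linarith)
    exact_mod_cast e5

end LoopGraph

/-! ### Signed linear functions -/

/-- A function of signs is signed linear if it is `ε ↦ ∑ i, ε i * α i` for integer weights `α`. -/
def IsSignedLinear {L : ℕ} (F : (Fin L → ℤˣ) → ℤ) (α : Fin L → ℤ) : Prop :=
  ∀ ε, F ε = ∑ i, (ε i : ℤ) * α i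

namespace IsSignedLinear

variable {L : ℕ} {F : (Fin L → ℤˣ) → ℤ} {α : Fin L → ℤ}

theorem apply_update_sub (h : IsSignedLinear F α) (ε : Fin L → ℤˣ) (i : Fin L) (a b : ℤˣ) :
    F (Function.update ε i a) - F (Function.update ε i b) = ((a : ℤ) - b) * α i := by
  rw [h, h, ← Finset.sum_sub_distrib, Finset.sum_eq_single i]
  · simp [sub_mul]
  · intro j _ hj
    simp [Function.update_of_ne hj]
  · simp

theorem isEssentialCoord_iff (h : IsSignedLinear F α) (i : Fin L) :
    IsEssentialCoord F i ↔ α i ≠ 0 := by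
  constructor
  · rintro ⟨x, a, b, hab⟩ h0
    have := h.apply_update_sub x i a b
    rw [h0, mul_zero] at this
    exact hab (sub_eq_zero.1 this)
  · intro h0
    refine ⟨1, 1, -1, fun he => h0 ?_⟩
    have := h.apply_update_sub 1 i 1 (-1)
    rw [he, sub_self] at this
    simpa using this.symm

theorem essentialArity_le (h : IsSignedLinear F α) : (essentialArity F : ℤ) ≤ ∑ i, |α i| := by
  classical
  have : {i | IsEssentialCoord F i} =
      ((Finset.univ.filter fun i => α i ≠ 0 : Finset (Fin L)) : Set _) := by
    ext i
    simp [h.isEssentialCoord_iff]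
  rw [essentialArity, this, Set.ncard_coe_finset, Finset.card_filter]
  push_cast
  refine Finset.sum_le_sum fun i _ => ?_
  split_ifs with h0
  · exact Int.one_le_abs h0
  · exact abs_nonneg _

theorem minorOf {m : ℕ} (h : IsSignedLinear F α) (π : Fin L → Fin m) :
    IsSignedLinear (minorOf π F) fun k => ∑ i with π i = k, α i := by
  intro ε
  rw [_root_.minorOf, h, ← Finset.sum_fiberwise Finset.univ π]
  refine Finset.sum_congr rfl fun k _ => ?_
  rw [Finset.mul_sum]
  refine Finset.sum_congr rfl fun i hi => ?_
  rw [Function.comp_apply, (Finset.mem_filter.1 hi).2]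

/-- The bound is attained by the signs `ε i` that match those of the weights. -/
theorem sum_abs_le (h : IsSignedLinear F α) {c : ℤ} (hc : ∀ ε, F ε ≤ c) : ∑ i, |α i| ≤ c := by
  classical
  refine le_trans (le_of_eq ?_) (hc fun i => if 0 ≤ α i then 1 else -1)
  rw [h]
  refine Finset.sum_congr rfl fun i _ => ?_
  split_ifs with h0
  · simp [abs_of_nonneg h0]
  · simp [abs_of_neg (not_le.1 h0)]

end IsSignedLinear

/-- An odd function of signs with odd values is signed linear as soon as the effect of switching
one sign does not depend on the other signs. -/
theorem exists_isSignedLinear {L : ℕ} {F : (Fin L → ℤˣ) → ℤ} (hodd : ∀ ε, Odd (F ε))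
    (hneg : ∀ ε, F (-ε) = -F ε)
    (hswitch : ∀ i ε ε' a b, F (Function.update ε i a) + F (Function.update ε' i b) =
      F (Function.update ε i b) + F (Function.update ε' i a)) :
    ∃ α, IsSignedLinear F α := by
  classical
  have hα (i : Fin L) : ∃ k : ℤ, F (Function.update 1 i (-1)) = F 1 - 2 * k := by
    obtain ⟨k, hk⟩ := (hodd 1).sub_odd (hodd (Function.update 1 i (-1)))
    exact ⟨k, by linarith⟩
  choose α hα using hα
  have key (ε : Fin L → ℤˣ) (S : Finset (Fin L)) :
      F (fun i => if i ∈ S then ε i else 1) = F 1 + ∑ i ∈ S, ((ε i : ℤ) - 1) * α i := by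
    induction S using Finset.induction_on with
    | empty => simp [Pi.one_def]
    | insert i S hi ih =>
      have e1 : (fun j => if j ∈ insert i S then ε j else 1) =
          Function.update (fun j => if j ∈ S then ε j else 1) i (ε i) := by
        funext j
        by_cases hj : j = i
        · subst hj; simp
        · simp [hj]
      have e2 : Function.update (fun j => if j ∈ S then ε j else 1) i 1 =
          (fun j => if j ∈ S then ε j else 1) := by
        funext j
        by_cases hj : j = i
        · subst hj; simp [hi]
        · simp [hj]
      have e3 : Function.update (1 : Fin L → ℤˣ) i 1 = 1 := Function.update_eq_self i 1
      rw [e1, Finset.sum_insert hi]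
      have sw := hswitch i (fun j => if j ∈ S then ε j else 1) 1 (ε i) 1
      rw [e2, e3, ih] at sw
      rcases Int.units_eq_one_or (ε i) with h | h
      · rw [h, e2, ih]
        simp
      · rw [h, hα] at sw
        rw [h]
        push_cast
        linarith
  have hlin (ε : Fin L → ℤˣ) : F ε = F 1 + ∑ i, ((ε i : ℤ) - 1) * α i := by
    simpa using key ε Finset.univ
  have h1 : F 1 = ∑ i, α i := by
    have h := hlin (-1)
    rw [hneg] at h
    simp only [Pi.neg_apply, Pi.one_apply, Units.val_neg, Units.val_one, ← Finset.mul_sum] at h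
    linarith
  refine ⟨α, fun ε => ?_⟩
  rw [hlin, h1, ← Finset.sum_add_distrib]
  exact Finset.sum_congr rfl fun i _ => by ring

/-- The minion of signed linear functions whose weights have odd sum and bounded absolute sum. -/
def signedLinearFamily (c : ℤ) : FunctionFamily ℤˣ ℤ := fun L =>
  {F | ∃ α : Fin L → ℤ, IsSignedLinear F α ∧ Odd (∑ i, α i) ∧ ∑ i, |α i| ≤ c}

theorem signedLinearFamily_isMinion {c : ℤ} (hc : 1 ≤ c) : IsMinion (signedLinearFamily c) where
  nonempty := ⟨1, fun ε => ε 0, 1, fun ε => by simp, by simp, by simpa using hc⟩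
  minor_mem := by
    rintro m n π g ⟨α, h, hodd, hle⟩
    refine ⟨_, h.minorOf π, ?_, le_trans ?_ hle⟩
    · rwa [Finset.sum_fiberwise]
    · rw [← Finset.sum_fiberwise Finset.univ π]
      exact Finset.sum_le_sum fun k _ => Finset.abs_sum_le_sum_abs _ _

theorem signedLinearFamily_boundedEssentialArity (c : ℤ) :
    BoundedEssentialArity (signedLinearFamily c) := by
  refine ⟨c.toNat, ?_⟩
  rintro n F ⟨α, h, -, hle⟩
  have := h.essentialArity_le.trans hle
  omega

theorem signedLinearFamily_hasNoConstants (c : ℤ) : HasNoConstants (signedLinearFamily c) := by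
  rintro n F ⟨α, h, hodd, -⟩ hconst
  have h0 (i) : α i = 0 := by
    by_contra hi
    exact hconst i ((h.isEssentialCoord_iff i).2 hi)
  simp [h0] at hodd

/-! ### Winding of polymorphisms -/

/-- The step in `(ℤ/n)ᴸ` that moves in coordinate `i` by the sign `ε i`. -/
def signStep (n : ℕ) {L : ℕ} (ε : Fin L → ℤˣ) : Fin L → ZMod n := fun i => ((ε i : ℤ) : ZMod n)

theorem signStep_neg (n : ℕ) {L : ℕ} (ε : Fin L → ℤˣ) : signStep n (-ε) = -signStep n ε := by
  funext i
  simp [signStep]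

namespace LoopGraph

variable {V : Type u} {H : LoopGraph V} {ω : V → V → ℤ} {n L : ℕ} {f : (Fin L → ZMod n) → V}

theorem adj_add_signStep (hf : f ∈ polymorphisms (cycle n) H L) (v : Fin L → ZMod n)
    (ε : Fin L → ℤˣ) : H.Adj (f v) (f (v + signStep n ε)) := by
  refine hf _ _ fun i => ?_
  rcases Int.units_eq_one_or (ε i) with h | h
  · left
    simp [signStep, h]
  · right
    simp [signStep, h]

variable [NeZero n]

/-- The winding, in half turns, of the image under `f` of the closed walk of length `n` that
starts at `v` and moves by `signStep n ε`. -/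
def windingFrom (ω : V → V → ℤ) (f : (Fin L → ZMod n) → V) (ε : Fin L → ℤˣ)
    (v : Fin L → ZMod n) : ℤ :=
  ∑ j : ZMod n, ω (f (v + j • signStep n ε)) (f (v + (j + 1) • signStep n ε))

/-- Neighbouring parallel walks bound a strip of squares, so they have the same winding. -/
theorem IsWindingForm.windingFrom_add_signStep (hω : H.IsWindingForm ω)
    (hf : f ∈ polymorphisms (cycle n) H L) (ε ε' : Fin L → ℤˣ) (v : Fin L → ZMod n) :
    windingFrom ω f ε (v + signStep n ε') = windingFrom ω f ε v := by
  let T (j : ZMod n) : ℤ := ω (f (v + j • signStep n ε)) (f (v + j • signStep n ε + signStep n ε'))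
  have hT : ∑ j, T (j + 1) = ∑ j, T j := Equiv.sum_comp (Equiv.addRight 1) T
  rw [← sub_eq_zero, windingFrom, windingFrom, ← Finset.sum_sub_distrib, ← sub_eq_zero.2 hT,
    ← Finset.sum_sub_distrib]
  refine Finset.sum_congr rfl fun j _ => ?_
  have e1 (j : ZMod n) : v + signStep n ε' + j • signStep n ε =
      v + j • signStep n ε + signStep n ε' := by abel
  have e2 : v + (j + 1) • signStep n ε = v + j • signStep n ε + signStep n ε := by
    rw [add_smul, one_smul, add_assoc]
  simp only [T, e1, e2]
  generalize v + j • signStep n ε = x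
  have a1 := adj_add_signStep hf x ε
  have a2 := adj_add_signStep hf (x + signStep n ε) ε'
  have a3 := adj_add_signStep hf (x + signStep n ε') ε
  have a4 := adj_add_signStep hf x ε'
  rw [add_right_comm] at a3
  have sq := hω.square a1 a2 (H.symm _ _ a3) (H.symm _ _ a4)
  rw [hω.antisymm a3, hω.antisymm a4] at sq
  linarith

/-- For odd `n`, the steps generate `(ℤ/n)ᴸ`: changing one sign changes a step by twice a
coordinate vector, and `2` is invertible. -/
theorem IsWindingForm.windingFrom_eq (hω : H.IsWindingForm ω) (hn : Odd n)
    (hf : f ∈ polymorphisms (cycle n) H L) (ε : Fin L → ℤˣ) (v : Fin L → ZMod n) :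
    windingFrom ω f ε v = windingFrom ω f ε 0 := by
  classical
  let P : AddSubgroup (Fin L → ZMod n) :=
    { carrier := {t | ∀ v, windingFrom ω f ε (v + t) = windingFrom ω f ε v}
      zero_mem' := fun v => by rw [add_zero]
      add_mem' := fun {a b} ha hb v => by rw [← add_assoc, hb, ha]
      neg_mem' := fun {a} ha v => by rw [← ha (v + -a), neg_add_cancel_right] }
  have hstep (ε') : signStep n ε' ∈ P := fun v => hω.windingFrom_add_signStep hf ε ε' v
  have htwo (i : Fin L) : Pi.single i (2 : ZMod n) ∈ P := by
    have := P.sub_mem (hstep 1) (hstep (Function.update 1 i (-1)))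
    convert this using 1
    funext j
    by_cases hj : j = i
    · subst hj
      simp [signStep]
      norm_num
    · simp [signStep, hj]
  have hsingle (i : Fin L) (c : ZMod n) : Pi.single i c ∈ P := by
    have hu : IsUnit (2 : ZMod n) := by
      have := (ZMod.isUnit_iff_coprime 2 n).2 (Nat.coprime_two_left.2 hn)
      exact_mod_cast this
    obtain ⟨d, hd⟩ := hu.dvd (a := c)
    have := P.nsmul_mem (htwo i) d.val
    rwa [← Pi.single_smul, nsmul_eq_mul, ZMod.natCast_zmod_val, mul_comm, ← hd] at this
  have hv : v ∈ P := by
    rw [← Finset.univ_sum_single v]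
    exact P.sum_mem fun i _ => hsingle i (v i)
  simpa using hv 0

/-- The sum of the winding form over all parallel edges in direction `ε`. -/
def totalForm (ω : V → V → ℤ) (f : (Fin L → ZMod n) → V) (ε : Fin L → ℤˣ) : ℤ :=
  ∑ v, ω (f v) (f (v + signStep n ε))

theorem IsWindingForm.totalForm_neg (hω : H.IsWindingForm ω)
    (hf : f ∈ polymorphisms (cycle n) H L) (ε : Fin L → ℤˣ) :
    totalForm ω f (-ε) = -totalForm ω f ε := by
  rw [totalForm, ← Equiv.sum_comp (Equiv.addRight (signStep n ε)), totalForm,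
    ← Finset.sum_neg_distrib]
  refine Finset.sum_congr rfl fun v _ => ?_
  rw [Equiv.coe_addRight, signStep_neg, add_neg_cancel_right]
  exact hω.antisymm (adj_add_signStep hf v ε)

/-- Two walks of length two with the same ends bound a square. -/
theorem IsWindingForm.totalForm_add_totalForm (hω : H.IsWindingForm ω)
    (hf : f ∈ polymorphisms (cycle n) H L) {ε ε' η η' : Fin L → ℤˣ}
    (h : signStep n ε + signStep n ε' = signStep n η + signStep n η') :
    totalForm ω f ε + totalForm ω f ε' = totalForm ω f η + totalForm ω f η' := by
  have shift (ε ε' : Fin L → ℤˣ) : totalForm ω f ε' =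
      ∑ v, ω (f (v + signStep n ε)) (f (v + (signStep n ε + signStep n ε'))) := by
    rw [totalForm, ← Equiv.sum_comp (Equiv.addRight (signStep n ε))]
    simp only [Equiv.coe_addRight, add_assoc]
  rw [shift ε ε', shift η η', totalForm, totalForm, ← Finset.sum_add_distrib,
    ← Finset.sum_add_distrib]
  refine Finset.sum_congr rfl fun v _ => ?_
  have a1 := adj_add_signStep hf v ε
  have a2 := adj_add_signStep hf (v + signStep n ε) ε'
  have a3 := adj_add_signStep hf (v + signStep n η) η'
  have a4 := adj_add_signStep hf v η
  rw [add_assoc] at a2 a3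
  rw [h] at a2 ⊢
  have sq := hω.square a1 a2 (H.symm _ _ a3) (H.symm _ _ a4)
  rw [hω.antisymm a3, hω.antisymm a4] at sq
  linarith

/-- Averaging the winding over all base points expresses it through `totalForm`. -/
theorem IsWindingForm.totalForm_eq (hω : H.IsWindingForm ω) (hn : Odd n)
    (hf : f ∈ polymorphisms (cycle n) H L) (ε : Fin L → ℤˣ) :
    (n : ℤ) * totalForm ω f ε = (n : ℤ) ^ L * windingFrom ω f ε 0 := by
  have h1 : ∑ v, windingFrom ω f ε v = (n : ℤ) ^ L * windingFrom ω f ε 0 := by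
    simp [hω.windingFrom_eq hn hf]
  rw [← h1]
  simp only [windingFrom]
  rw [Finset.sum_comm]
  have h2 (j : ZMod n) : ∑ v, ω (f (v + j • signStep n ε)) (f (v + (j + 1) • signStep n ε)) =
      totalForm ω f ε := by
    rw [totalForm, ← Equiv.sum_comp (Equiv.addRight (j • signStep n ε))
      fun v => ω (f v) (f (v + signStep n ε))]
    simp only [Equiv.coe_addRight, add_smul, one_smul, add_assoc]
  simp [h2]

theorem IsWindingForm.odd_windingFrom (hω : H.IsWindingForm ω) (hn : Odd n)
    (hf : f ∈ polymorphisms (cycle n) H L) (ε : Fin L → ℤˣ) (v : Fin L → ZMod n) :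
    Odd (windingFrom ω f ε v) := by
  have h (j : ZMod n) : ∃ k, ω (f (v + j • signStep n ε)) (f (v + (j + 1) • signStep n ε)) =
      2 * k + 1 := by
    rw [add_smul, one_smul, ← add_assoc]
    exact hω.odd (adj_add_signStep hf _ ε)
  choose k hk using h
  obtain ⟨m, rfl⟩ := hn
  refine ⟨∑ j, k j + m, ?_⟩
  simp only [windingFrom, hk, Finset.sum_add_distrib, ← Finset.mul_sum, Finset.sum_const,
    Finset.card_univ, ZMod.card]
  simp
  ring

theorem IsWindingForm.exists_isSignedLinear_windingFrom (hω : H.IsWindingForm ω) (hn : Odd n)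
    (hf : f ∈ polymorphisms (cycle n) H L) :
    ∃ α, IsSignedLinear (fun ε => windingFrom ω f ε 0) α := by
  have hpow : (n : ℤ) ^ L ≠ 0 := pow_ne_zero _ (Nat.cast_ne_zero.2 (NeZero.ne n))
  refine exists_isSignedLinear (fun ε => hω.odd_windingFrom hn hf ε 0) (fun ε => ?_)
    fun i ε ε' a b => ?_
  · refine mul_left_cancel₀ hpow ?_
    rw [← hω.totalForm_eq hn hf, hω.totalForm_neg hf, mul_neg, mul_neg, hω.totalForm_eq hn hf]
  · refine mul_left_cancel₀ hpow ?_
    rw [mul_add, mul_add]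
    simp only [← hω.totalForm_eq hn hf]
    rw [← mul_add, ← mul_add, hω.totalForm_add_totalForm hf]
    funext j
    by_cases hj : j = i
    · subst hj
      simp [signStep, add_comm]
    · simp [signStep, hj]

theorem windingFrom_le {P : ℤ} (hP : ∀ x y, ω x y ≤ P) (ε : Fin L → ℤˣ) (v : Fin L → ZMod n) :
    windingFrom ω f ε v ≤ n * P := by
  refine (Finset.sum_le_card_nsmul _ _ P fun j _ => hP _ _).trans ?_
  simp

end LoopGraph

theorem mainTheorem6 {V : Type*} [Finite V] (H : LoopGraph V)
    (hH : Z2MapsTo H.homComplex.Realization (Z2Sphere 1)) (n : ℕ) (hn : Odd n) :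
    ∃ (A B : Type) (M : FunctionFamily A B),
      IsMinion M ∧ BoundedEssentialArity M ∧ HasNoConstants M ∧
        ∃ ξ : ∀ L : ℕ, polymorphisms (LoopGraph.cycle n) H L → M L, IsMinionHom ξ := by
  have : NeZero n := ⟨hn.pos.ne'⟩
  obtain ⟨ω, hω⟩ := H.exists_isWindingForm hH
  obtain ⟨P, hP⟩ := (Set.finite_range fun e : V × V => ω e.1 e.2).bddAbove
  replace hP (x y : V) : ω x y ≤ P := hP ⟨(x, y), rfl⟩
  -- The homomorphism sends `f` to the function `ε ↦ windingFrom ω f ε 0`. It preserves minors by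
  -- definition: a minor of `f` along the walk with signs `ε` is `f` along the walk with signs `ε ∘ π`.
  -- The maximum with `1` keeps the target minion non-empty when there are no polymorphisms.
  refine ⟨ℤˣ, ℤ, signedLinearFamily (max 1 (n * P)), signedLinearFamily_isMinion (le_max_left _ _),
    signedLinearFamily_boundedEssentialArity _, signedLinearFamily_hasNoConstants _,
    fun L f => ⟨fun ε => LoopGraph.windingFrom ω f.1 ε 0, ?_⟩, fun _ _ _ _ _ => rfl⟩
  obtain ⟨α, hα⟩ := hω.exists_isSignedLinear_windingFrom hn f.2
  refine ⟨α, hα, ?_, hα.sum_abs_le fun ε =>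
    (LoopGraph.windingFrom_le hP ε 0).trans (le_max_right _ _)⟩
  -- The sum of the weights is the winding along the diagonal, where all signs are `1`.
  have h1 := hα 1
  simp only [Pi.one_apply, Units.val_one, one_mul] at h1
  rw [← h1]
  exact hω.odd_windingFrom hn f.2 1 0
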